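/- Let $K$ be a field of characteristic zero and let $\mathcal F$ be the field of formal series $a=\sum_{i\ge 0}a_it^{\alpha_i}$ with $a_i\in K$ and real exponents $\alpha_0<\alpha_1<\cdots$ without limit points. Write $\|a\|$ for the least exponent that occurs in $a\neq 0$, put $\|0\|=\infty$, and let $R=\{a\in\mathcal F:\|a\|\ge 0\}$. For $\mu\in\mathbb R^r$ let $D_\mu=\mathrm{diag}(t^{\mu_1},\dots,t^{\mu_r})$. For an invertible $r\times r$ matrix $M$ over $\mathcal F$, $inv(M)=\mu$ means that $\mu_1\ge\cdots\ge\mu_r$ and $PMQ^{-1}=D_\mu$ for some $P,Q\in GL_r(R)$. Pairs $(M,N)$ and $(A,B)$ of invertible matrices are pair equivalent if $(A,B)=(PMQ^{-1},QNT^{-1})$ for some $P,Q,T\in GL_r(R)$. A matrix $Q\in GL_r(R)$ is $\mu$-admissible if $D_\mu QD_\mu^{-1}\in GL_r(R)$. For index sets $I=(i_1<\cdots<i_k)$, $J=(j_1<\cdots<j_k)$ in $\{1,\dots,r\}$, $W_{IJ}$ denotes the minor of $W$ with rows $I$ and columns $J$, $|\mu_I|=\mu_{i_1}+\cdots+\mu_{i_k}$,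 and $I\subseteq J$ means $i_s\le j_s$ for all $s$. A matrix $N^*$ is $\mu$-generic associated to an invertible $N'$ if it is upper triangular, $N^*=QN'T^{-1}$ with $T\in GL_r(R)$ and $Q$ $\mu$-admissible such that $Q=Q_UQ_L=\widehat{Q_L}\widehat{Q_U}$ with $Q_U,\widehat{Q_U}$ upper and $Q_L,\widehat{Q_L}$ lower triangular matrices in $GL_r(R)$, and for all index sets $I\subseteq H\subseteq J$ of equal length $$\|N^*_{IJ}\|\le\|N^*_{HJ}\|\le\|N^*_{IJ}\|+|\mu_I|-|\mu_H|,\qquad \|N^*_{IJ}\|\le\|N^*_{IH}\|.$$ Let $\|(p^\wedge,\dots,q^\wedge)\|$ denote the order of the minor of $N^*$ formed by all rows except $p,p+1,\dots,q$ and the equally many right-most columns (there is no row $0$; nothing is omitted if $p>q$; the empty minor is $1$). **Theorem.** Let $M,N$ be invertible $r\times r$ matrices over $\mathcal F$ with $inv(M)=\mu$, $inv(N)=\nu$, $inv(MN)=\lambda$. Let $(D_\mu,N')$ be pair equivalent to $(M,N)$, and let $N^*$ be a $\mu$-generic matrix associated to $N'$. Then all the minors just described are nonzero. Hence one can define real numbers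 $k_{ij}$, $1\le i\le j\le r$, by $$k_{ij}=\Big(\|((j-i)^\wedge,\dots,(j-1)^\wedge)\|-\|((j-i+1)^\wedge,\dots,j^\wedge)\|\Big)-\Big(\|((j-i+1)^\wedge,\dots,(j-1)^\wedge)\|-\|((j-i+2)^\wedge,\dots,j^\wedge)\|\Big),$$ and equivalently $k_{1j}+\cdots+k_{ij}=\|((j-i)^\wedge,\dots,(j-1)^\wedge)\|-\|((j-i+1)^\wedge,\dots,j^\wedge)\|$ for all $1\le i\le j\le r$. The array $\{k_{ij}\}$ is an $L\mathbb R$-filling of type $(\mu,\nu;\lambda)$. That is, $\mu,\nu,\lambda$ are weakly decreasing, $\sum_i\mu_i+\sum_i\nu_i=\sum_i\lambda_i$, and 1. $\mu_j+\sum_{s=1}^jk_{sj}=\lambda_j$ for $1\le j\le r$ and $\sum_{s=i}^rk_{is}=\nu_i$ for $1\le i\le r$; 2. $k_{ij}\ge 0$ for $i<j$ (the edge parts $k_{ii}$ are arbitrary real numbers and may be negative); 3. $\mu_j+k_{1j}+\cdots+k_{ij}\le\mu_{j-1}+k_{1,j-1}+\cdots+k_{i-1,j-1}$ for $2\le j\le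 r$, $1\le i\le j$; 4. $\sum_{s=i+1}^{j+1}k_{i+1,s}\le\sum_{s=i}^jk_{is}$ for $1\le i\le j\le r-1$. -/

import Mathlib

noncomputable section

/-! ### The field of series with sparse real exponents -/

/-- A Hahn series with real exponents is sparse if only finitely many of its exponents lie below
any given bound, i.e. its exponents can be listed as an increasing sequence without limit points. -/
def HahnSeries.Sparse {K : Type*} [Field K] (x : HahnSeries ℝ K) : Prop :=
  ∀ c : ℝ, (x.support ∩ Set.Iic c).Finite

theorem HahnSeries.Sparse.add {K : Type*} [Field K] {x y : HahnSeries ℝ K}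
    (hx : x.Sparse) (hy : y.Sparse) : (x + y).Sparse := fun c =>
  ((hx c).union (hy c)).subset fun g hg => by
    rcases HahnSeries.support_add_subset x y hg.1 with h | h
    · exact Or.inl ⟨h, hg.2⟩
    · exact Or.inr ⟨h, hg.2⟩

theorem HahnSeries.Sparse.mul {K : Type*} [Field K] {x y : HahnSeries ℝ K}
    (hx : x.Sparse) (hy : y.Sparse) : (x * y).Sparse := fun c =>
  ((hx (c - y.order)).image2 (fun a b : ℝ => a + b) (hy (c - x.order))).subset fun g hg => by
    obtain ⟨a, ha, b, hb, rfl⟩ := Set.mem_add.1 (HahnSeries.support_mul_subset hg.1)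
    have h1 := HahnSeries.order_le_of_coeff_ne_zero (Function.mem_support.mp ha)
    have h2 := HahnSeries.order_le_of_coeff_ne_zero (Function.mem_support.mp hb)
    have h3 : a + b ≤ c := hg.2
    exact ⟨a, ⟨ha, by simp only [Set.mem_Iic]; linarith⟩, b,
      ⟨hb, by simp only [Set.mem_Iic]; linarith⟩, rfl⟩

theorem HahnSeries.Sparse.single {K : Type*} [Field K] (a : ℝ) (r : K) :
    (HahnSeries.single a r).Sparse := fun _ =>
  (Set.finite_singleton a).subset fun _ hg => HahnSeries.support_single_subset hg.1

theorem HahnSeries.Sparse.neg {K : Type*} [Field K] {x : HahnSeries ℝ K}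
    (hx : x.Sparse) : (-x).Sparse := fun c => by
  rw [HahnSeries.support_neg]; exact hx c

theorem HahnSeries.Sparse.one {K : Type*} [Field K] : (1 : HahnSeries ℝ K).Sparse :=
  HahnSeries.Sparse.single 0 1

theorem HahnSeries.Sparse.pow {K : Type*} [Field K] {x : HahnSeries ℝ K}
    (hx : x.Sparse) (n : ℕ) : (x ^ n).Sparse := by
  induction n with
  | zero => simpa using HahnSeries.Sparse.one
  | succ n ih => rw [pow_succ]; exact ih.mul hx

theorem HahnSeries.Sparse.hsum_powers {K : Type*} [Field K] {y : HahnSeries ℝ K}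
    (hy : y.Sparse) (h0 : 0 < y.orderTop) : (HahnSeries.SummableFamily.powers y).hsum.Sparse := by
  obtain ⟨d, hd, hdy⟩ : ∃ d : ℝ, 0 < d ∧ (d : WithTop ℝ) ≤ y.orderTop := by
    by_cases h : y = 0
    · exact ⟨1, one_pos, by simp [h]⟩
    · exact ⟨y.order, (HahnSeries.zero_lt_orderTop_iff h).1 h0,
        (HahnSeries.order_eq_orderTop_of_ne_zero h).le⟩
  intro c
  obtain ⟨m, hm⟩ := exists_nat_gt (c / d)
  refine ((Set.finite_Iio m).biUnion fun n _ => hy.pow n c).subset fun g hg => ?_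
  obtain ⟨n, hn⟩ := Set.mem_iUnion.1 (HahnSeries.SummableFamily.support_hsum_subset hg.1)
  rw [HahnSeries.SummableFamily.powers_of_orderTop_pos h0] at hn
  refine Set.mem_iUnion₂.2 ⟨n, ?_, hn, hg.2⟩
  have h1 : (y ^ n).orderTop ≤ g :=
    HahnSeries.orderTop_le_of_coeff_ne_zero (Function.mem_support.mp hn)
  have h2 : ((n • d : ℝ) : WithTop ℝ) ≤ g := by
    rw [WithTop.coe_nsmul]
    exact ((nsmul_le_nsmul_right hdy n).trans HahnSeries.orderTop_nsmul_le_orderTop_pow).trans h1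
  have h3 : (n : ℝ) * d ≤ g := by simpa using WithTop.coe_le_coe.1 h2
  have h4 : g ≤ c := hg.2
  have h5 : (n : ℝ) ≤ c / d := by rw [le_div_iff₀ hd]; linarith
  exact_mod_cast lt_of_le_of_lt h5 hm

theorem HahnSeries.Sparse.inv {K : Type*} [Field K] {x : HahnSeries ℝ K}
    (hx : x.Sparse) : (x⁻¹).Sparse := by
  by_cases h : x = 0
  · simpa [h] using h ▸ hx
  · have h0 := HahnSeries.unit_aux x
      (inv_mul_cancel₀ (HahnSeries.leadingCoeff_ne_zero.mpr h)) _ (neg_add_cancel x.order)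
    have h1 : (1 - HahnSeries.single (-x.order) (x.leadingCoeff)⁻¹ * x).Sparse := by
      rw [sub_eq_add_neg]
      exact HahnSeries.Sparse.one.add ((HahnSeries.Sparse.single _ _).mul hx).neg
    exact (HahnSeries.Sparse.single _ _).mul (h1.hsum_powers h0)

/-- The sparse series form a subfield of the field of Hahn series with real exponents. -/
def sparseSubfield (K : Type*) [Field K] : Subfield (HahnSeries ℝ K) where
  carrier := {x | x.Sparse}
  mul_mem' := HahnSeries.Sparse.mul
  one_mem' := HahnSeries.Sparse.one
  add_mem' := HahnSeries.Sparse.add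
  zero_mem' := fun _ => by simp
  neg_mem' := HahnSeries.Sparse.neg
  inv_mem' := fun _ => HahnSeries.Sparse.inv

/-- The field `𝓕` of formal series `∑ aᵢ t ^ αᵢ` with coefficients in `K` and real exponents
`α₀ < α₁ < ⋯` without limit points. -/
abbrev SeriesField (K : Type*) [Field K] : Type _ := sparseSubfield K

namespace SeriesField

variable {K : Type*} [Field K]

/-- The order `‖a‖`: the least exponent of `a`, and `‖0‖ = ∞`. -/
def ord (a : SeriesField K) : WithTop ℝ := (a : HahnSeries ℝ K).orderTop

/-- The order of a nonzero series, as a real number (with value `0` at `a = 0`). -/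
def realOrd (a : SeriesField K) : ℝ := (a : HahnSeries ℝ K).order

/-- The monomial `t ^ s`. -/
def tPow (s : ℝ) : SeriesField K :=
  ⟨HahnSeries.single s 1, HahnSeries.Sparse.single s 1⟩

theorem tPow_ne_zero (s : ℝ) : (tPow s : SeriesField K) ≠ 0 := fun h =>
  one_ne_zero (α := K) (HahnSeries.single_eq_zero_iff.1 (congrArg Subtype.val h))

/-- The valuation ring `R = {a ∈ 𝓕 : ‖a‖ ≥ 0}`. -/
def valRing (K : Type*) [Field K] : Subring (SeriesField K) where
  carrier := {a | 0 ≤ ord a}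
  mul_mem' := fun {a b} ha hb => by
    change 0 ≤ ((a : HahnSeries ℝ K) * (b : HahnSeries ℝ K)).orderTop
    exact (add_nonneg ha hb).trans HahnSeries.orderTop_add_le_mul
  one_mem' := by
    change 0 ≤ (1 : HahnSeries ℝ K).orderTop
    rw [HahnSeries.orderTop_one]
  add_mem' := fun {a b} ha hb =>
    (le_min ha hb).trans (HahnSeries.min_orderTop_le_orderTop_add (x := a.1) (y := b.1))
  zero_mem' := by
    change 0 ≤ (0 : HahnSeries ℝ K).orderTop
    simp
  neg_mem' := fun {a} ha => by
    change 0 ≤ (-(a : HahnSeries ℝ K)).orderTop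
    rw [HahnSeries.orderTop_neg]; exact ha

end SeriesField

open SeriesField

/-! ### Matrices

`M_r(𝓕)`, the set of invertible `r × r` matrices over `𝓕`, is `GL (Fin r) (SeriesField K)`.
Rows and columns are numbered by `Fin r`, so `0` stands for the first one. -/

/-- `GL_r(R)`, as a subgroup of the group of invertible matrices over `𝓕`. -/
def integralGL (K : Type*) [Field K] (r : ℕ) :
    Subgroup (Matrix.GeneralLinearGroup (Fin r) (SeriesField K)) :=
  (Matrix.GeneralLinearGroup.map (n := Fin r) (valRing K).subtype).range

/-- `D_μ = diag(t ^ μ₁, …, t ^ μ_r)`. -/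
def diagT (K : Type*) [Field K] {r : ℕ} (μ : Fin r → ℝ) :
    Matrix.GeneralLinearGroup (Fin r) (SeriesField K) :=
  Matrix.GeneralLinearGroup.mkOfDetNeZero (Matrix.diagonal fun i => tPow (μ i)) (by
    rw [Matrix.det_diagonal]
    exact Finset.prod_ne_zero_iff.2 fun i _ => tPow_ne_zero (μ i))

/-- `inv(M) = μ`: the `ℝ`-partition `μ₁ ≥ ⋯ ≥ μ_r` is the invariant partition of `M`. -/
def IsInvariantPartition {K : Type*} [Field K] {r : ℕ}
    (M : Matrix.GeneralLinearGroup (Fin r) (SeriesField K)) (μ : Fin r → ℝ) : Prop :=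
  Antitone μ ∧ ∃ P ∈ integralGL K r, ∃ Q ∈ integralGL K r, P * M * Q⁻¹ = diagT K μ

/-- Pair equivalence: `(A, B) = (P M Q⁻¹, Q N T⁻¹)` with `P, Q, T ∈ GL_r(R)`. -/
def PairEquivalent {K : Type*} [Field K] {r : ℕ}
    (M N A B : Matrix.GeneralLinearGroup (Fin r) (SeriesField K)) : Prop :=
  ∃ P ∈ integralGL K r, ∃ Q ∈ integralGL K r, ∃ T ∈ integralGL K r,
    A = P * M * Q⁻¹ ∧ B = Q * N * T⁻¹

/-- `Q ∈ GL_r(R)` is `μ`-admissible if `D_μ Q D_μ⁻¹ ∈ GL_r(R)`. -/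
def IsAdmissible {K : Type*} [Field K] {r : ℕ} (μ : Fin r → ℝ)
    (Q : Matrix.GeneralLinearGroup (Fin r) (SeriesField K)) : Prop :=
  Q ∈ integralGL K r ∧ diagT K μ * Q * (diagT K μ)⁻¹ ∈ integralGL K r

/-- The minor `W_{IJ}` with rows `i₁, …, i_k` and columns `j₁, …, j_k`. -/
def Matrix.minorIJ {A : Type*} [CommRing A] {r k : ℕ} (W : Matrix (Fin r) (Fin r) A)
    (I J : Fin k ↪o Fin r) : A :=
  (W.submatrix I J).det

/-- The relation `I ⊆ H` between index sets of the same length: `i_s ≤ h_s` for all `s`. -/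
def IndexLE {r k : ℕ} (I H : Fin k ↪o Fin r) : Prop := ∀ s, I s ≤ H s

/-- `N*` is a `μ`-generic matrix associated to `N`. -/
structure IsMuGeneric {K : Type*} [Field K] {r : ℕ} (μ : Fin r → ℝ)
    (N Nstar : Matrix.GeneralLinearGroup (Fin r) (SeriesField K)) : Prop where
  /-- `N*` is upper triangular. -/
  upper : Nstar.val.IsUpperTriangular
  /-- `N* = Q N T⁻¹` with `T ∈ GL_r(R)` and a `μ`-admissible `Q = Q_U Q_L = Q_L' Q_U'`,
  the factors being upper and lower triangular elements of `GL_r(R)`. -/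
  factor : ∃ Q T : Matrix.GeneralLinearGroup (Fin r) (SeriesField K),
    IsAdmissible μ Q ∧ T ∈ integralGL K r ∧ Nstar = Q * N * T⁻¹ ∧
    (∃ QU ∈ integralGL K r, ∃ QL ∈ integralGL K r,
      QU.val.IsUpperTriangular ∧ QL.val.transpose.IsUpperTriangular ∧ Q = QU * QL) ∧
    ∃ QL' ∈ integralGL K r, ∃ QU' ∈ integralGL K r,
      QL'.val.transpose.IsUpperTriangular ∧ QU'.val.IsUpperTriangular ∧ Q = QL' * QU'
  /-- `‖N*_{IJ}‖ ≤ ‖N*_{HJ}‖` for `I ⊆ H ⊆ J`. -/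
  row_le : ∀ (k : ℕ) (I H J : Fin k ↪o Fin r), IndexLE I H → IndexLE H J →
    ord (Nstar.val.minorIJ I J) ≤ ord (Nstar.val.minorIJ H J)
  /-- `‖N*_{HJ}‖ ≤ ‖N*_{IJ}‖ + |μ_I| - |μ_H|` for `I ⊆ H ⊆ J`. -/
  gap_le : ∀ (k : ℕ) (I H J : Fin k ↪o Fin r), IndexLE I H → IndexLE H J →
    ord (Nstar.val.minorIJ H J) ≤
      ord (Nstar.val.minorIJ I J) + ((∑ s, μ (I s) - ∑ s, μ (H s) : ℝ) : WithTop ℝ)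
  /-- `‖N*_{IJ}‖ ≤ ‖N*_{IH}‖` for `I ⊆ H ⊆ J`. -/
  col_le : ∀ (k : ℕ) (I H J : Fin k ↪o Fin r), IndexLE I H → IndexLE H J →
    ord (Nstar.val.minorIJ I J) ≤ ord (Nstar.val.minorIJ I H)

/-! ### The array of real numbers determined by a matrix -/

/-- All rows except those with (one-based) numbers `p, p + 1, …, q`. There is no row `0`, and
nothing is omitted if `p > q`. -/
def omittedRows (r p q : ℕ) : Finset (Fin r) :=
  Finset.univ.filter fun x => ¬ (p ≤ x.val + 1 ∧ x.val + 1 ≤ q)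

/-- The right-most `k` columns. -/
def lastColumns {r k : ℕ} (h : k ≤ r) : Fin k ↪o Fin r :=
  OrderEmbedding.ofStrictMono (fun s => ⟨r - k + s.val, by omega⟩)
    fun a b hab => Fin.mk_lt_mk.2 (Nat.add_lt_add_left hab _)

/-- The minor of `W` with rows `p, …, q` omitted, using the right-most columns. -/
def omittedMinor {A : Type*} [CommRing A] {r : ℕ} (W : Matrix (Fin r) (Fin r) A) (p q : ℕ) : A :=
  W.minorIJ ((omittedRows r p q).orderEmbOfFin rfl)
    (lastColumns (by simpa using (omittedRows r p q).card_le_univ))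

/-- `‖(p^, …, q^)‖`, the order of the minor of `W` with rows `p, …, q` omitted, using the
right-most columns. -/
def omittedOrder {K : Type*} [Field K] {r : ℕ}
    (W : Matrix (Fin r) (Fin r) (SeriesField K)) (p q : ℕ) : ℝ :=
  realOrd (omittedMinor W p q)

/-- `‖((j-i)^, …, (j-1)^)‖ - ‖((j-i+1)^, …, j^)‖` for one-based indices `i ≤ j`
(equal to `0` for `i = 0`). -/
def partialPart {K : Type*} [Field K] {r : ℕ}
    (W : Matrix (Fin r) (Fin r) (SeriesField K)) (i j : ℕ) : ℝ :=
  omittedOrder W (j - i) (j - 1) - omittedOrder W (j - i + 1) j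

/-- The part `k_ij`, the difference of two consecutive partial sums `k_1j + ⋯ + k_ij`; the
zero-based indices `i ≤ j` stand for the one-based indices `i + 1 ≤ j + 1`. -/
def fillingPart {K : Type*} [Field K] {r : ℕ}
    (W : Matrix (Fin r) (Fin r) (SeriesField K)) (i j : Fin r) : ℝ :=
  partialPart W (i.val + 1) (j.val + 1) - partialPart W i.val (j.val + 1)

/-! ### `ℝ`-valued Littlewood-Richardson fillings -/

/-- `{k_ij : i ≤ j}` is an `ℝ`-valued Littlewood-Richardson filling of type `(μ, ν; λ)`.
Only the values `k i j` with `i ≤ j` matter. -/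
structure IsLRFilling {r : ℕ} (μ ν lam : Fin r → ℝ) (k : Fin r → Fin r → ℝ) : Prop where
  antitone_mu : Antitone μ
  antitone_nu : Antitone ν
  antitone_lam : Antitone lam
  size : ∑ i, μ i + ∑ i, ν i = ∑ i, lam i
  sum_col : ∀ j, μ j + ∑ s ∈ Finset.Iic j, k s j = lam j
  sum_row : ∀ i, ∑ s ∈ Finset.Ici i, k i s = ν i
  nonneg : ∀ i j, i < j → 0 ≤ k i j
  /-- Column strictness, where `j'` is the row before `j`. -/
  column : ∀ i j j' : Fin r, j'.val + 1 = j.val → i ≤ j →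
    μ j + ∑ s ∈ Finset.Iic i, k s j ≤ μ j' + ∑ s ∈ Finset.Iio i, k s j'
  /-- The word condition, where `i'` and `j'` are the successors of `i` and `j`. -/
  word : ∀ i j i' j' : Fin r, i'.val = i.val + 1 → j'.val = j.val + 1 → i ≤ j →
    ∑ s ∈ Finset.Icc i' j', k i' s ≤ ∑ s ∈ Finset.Icc i j, k i s

end

/-! For a row set `X` write `[X]` for the order of the minor of `N*` on the rows `X` and the
right-most columns (`rowOrd`). All these minors are nonzero: by `row_le` their orders are bounded by
that of the lower right corner, a product of diagonal entries. The totals come from invariant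
factors: the sum of the `k` smallest invariants of a matrix is the least order of its `k × k`
minors. The inequalities of genericity place this minimum in the upper right corner for `N*`, which
gives `ν` (`rowOrd_omittedRows_top`), and in the lower right corner for `D_μ N*`, which gives `λ`
(`rowOrd_omittedRows_one`). The sums over the array telescope to differences of such corners. Each
remaining inequality compares the values of `[·]` on a common set `C` enlarged by at most two rows.
Condition 4 is a Sylvester determinant identity together with `col_le` (`rowOrd_insert_add_le`).
Conditions 2 and 3 use the tropical three-term Plücker relation (`min_rowOrd_le`), whose two
alternatives are both settled by exchanging one row: `row_le` for 2, `gap_le` for 3. -/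

noncomputable section

open SeriesField

/-! ### The order as a valuation. -/

namespace SeriesField

variable {K : Type*} [Field K]

/-- The order as an additive valuation on the field of series. -/
def ordVal (K : Type*) [Field K] : AddValuation (SeriesField K) (WithTop ℝ) :=
  (HahnSeries.addVal ℝ K).comap (sparseSubfield K).subtype

theorem ord_mul (a b : SeriesField K) : ord (a * b) = ord a + ord b := (ordVal K).map_mul a b

theorem ord_neg (a : SeriesField K) : ord (-a) = ord a := (ordVal K).map_neg a

theorem min_ord_le_ord_sub (a b : SeriesField K) : min (ord a) (ord b) ≤ ord (a - b) :=
  (ordVal K).map_sub a b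

theorem ord_eq_top_iff {a : SeriesField K} : ord a = ⊤ ↔ a = 0 := (ordVal K).top_iff

theorem ord_zero : ord (0 : SeriesField K) = ⊤ := ord_eq_top_iff.2 rfl

theorem ord_prod {ι : Type*} (s : Finset ι) (f : ι → SeriesField K) :
    ord (∏ i ∈ s, f i) = ∑ i ∈ s, ord (f i) := by
  classical
  induction s using Finset.induction_on with
  | empty => exact (ordVal K).map_one
  | insert a s ha ih => rw [Finset.prod_insert ha, Finset.sum_insert ha, ord_mul, ih]

theorem le_ord_sum {ι : Type*} {s : Finset ι} {f : ι → SeriesField K} {c : WithTop ℝ}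
    (h : ∀ i ∈ s, c ≤ ord (f i)) : c ≤ ord (∑ i ∈ s, f i) :=
  (ordVal K).map_le_sum h

theorem coe_realOrd {a : SeriesField K} (ha : a ≠ 0) : (realOrd a : WithTop ℝ) = ord a :=
  HahnSeries.order_eq_orderTop_of_ne_zero fun h => ha (Subtype.ext h)

theorem ord_tPow (s : ℝ) : ord (tPow s : SeriesField K) = s :=
  HahnSeries.orderTop_single one_ne_zero

theorem ord_sign_smul {n : Type*} [Fintype n] [DecidableEq n] (σ : Equiv.Perm n)
    (a : SeriesField K) : ord (Equiv.Perm.sign σ • a) = ord a := by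
  rcases Int.units_eq_one_or (Equiv.Perm.sign σ) with h | h <;> simp [h, ord_neg, Units.smul_def]

end SeriesField

/-! ### Minors up to sign, under integral multiplication, and bordered minors. -/

section Minors

variable {K : Type*} [Field K] {m n ι κ : Type*} [Fintype ι] [DecidableEq ι]
  [Fintype κ] [DecidableEq κ]

/-- Up to sign, a minor depends only on its sets of rows and columns. -/
theorem ord_det_submatrix_congr (W : Matrix m n (SeriesField K)) {f : ι → m} {g : ι → n}
    {I : κ → m} {J : κ → n} (hf : f.Injective) (hg : g.Injective) (hI : I.Injective)
    (hJ : J.Injective) (hfI : Set.range f = Set.range I) (hgJ : Set.range g = Set.range J) :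
    ord (W.submatrix f g).det = ord (W.submatrix I J).det := by
  let e₁ : ι ≃ κ := (Equiv.ofInjective f hf).trans
    ((Equiv.setCongr hfI).trans (Equiv.ofInjective I hI).symm)
  let e₂ : ι ≃ κ := (Equiv.ofInjective g hg).trans
    ((Equiv.setCongr hgJ).trans (Equiv.ofInjective J hJ).symm)
  have h1 : f = I ∘ e₁ := by
    funext x; simp [e₁, Equiv.apply_ofInjective_symm]
  have h2 : g = J ∘ e₂ := by
    funext x; simp [e₂, Equiv.apply_ofInjective_symm]
  have h3 : W.submatrix f g =
      (((W.submatrix I J).submatrix id (e₁.symm.trans e₂)).submatrix e₁ e₁) := by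
    rw [h1, h2]; ext; simp
  rw [h3, Matrix.det_submatrix_equiv_self, Matrix.det_permute', ← zsmul_eq_mul]
  exact ord_sign_smul (e₁.symm.trans e₂) _

/-- A lower bound for the orders of all minors of size `ι` also holds after multiplication by an
integral matrix on the left. -/
theorem le_ord_det_submatrix_mul [Fintype m] {c : WithTop ℝ} (P : Matrix m m (SeriesField K))
    (hP : ∀ i j, 0 ≤ ord (P i j)) (W : Matrix m n (SeriesField K)) (g : ι → n)
    (h : ∀ f : ι → m, c ≤ ord (W.submatrix f g).det) (f : ι → m) :
    c ≤ ord ((P * W).submatrix f g).det := by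
  classical
  have h1 : (P * W).submatrix f g = fun s => ∑ i, P (f s) i • fun t => W i (g t) := by
    ext s t; simp [Matrix.mul_apply]
  -- Multilinearity in the rows gives an unsorted Cauchy-Binet expansion. Its row choices may
  -- repeat, so the bound is assumed for arbitrary functions `f`.
  have h2 := (Matrix.detRowAlternating (R := SeriesField K) (n := ι)).toMultilinearMap.map_sum
    (fun s i => P (f s) i • fun t => W i (g t))
  rw [h1]
  refine (le_ord_sum fun F _ => ?_).trans (congrArg ord h2).ge
  refine le_of_le_of_eq ?_ (congrArg ord
    (MultilinearMap.map_smul_univ _ (fun s => P (f s) (F s)) (fun s t => W (F s) (g t)))).symm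
  rw [smul_eq_mul, ord_mul, ord_prod]
  exact le_add_of_nonneg_of_le (Finset.sum_nonneg fun _ _ => hP _ _) (h F)

/-- All minors bordering a fixed nonzero minor are proportional to the minors of one matrix. -/
theorem exists_det_bordered {F : Type*} [Field F] (W : Matrix m n F) (ρ : κ → m) (L : κ → n)
    (hD : (W.submatrix ρ L).det ≠ 0) :
    ∃ S : Matrix m n F, ∀ (k : ℕ) (f : Fin k → m) (g : Fin k → n),
      (W.submatrix (Sum.elim f ρ) (Sum.elim g L)).det =
        (W.submatrix ρ L).det * (S.submatrix f g).det := by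
  let _ := Matrix.invertibleOfIsUnitDet (W.submatrix ρ L) hD.isUnit
  -- `S` collects the Schur complements of the fixed block, for all rows and columns at once.
  refine ⟨W - W.submatrix id L * ⅟(W.submatrix ρ L) * W.submatrix ρ id, fun k f g => ?_⟩
  have h : W.submatrix (Sum.elim f ρ) (Sum.elim g L) = Matrix.fromBlocks (W.submatrix f g)
      (W.submatrix f L) (W.submatrix ρ g) (W.submatrix ρ L) := by
    ext i j; rcases i with i | i <;> rcases j with j | j <;> rfl
  rw [h, Matrix.det_fromBlocks₂₂]
  congr 2

end Minors

/-! ### The order on index sets. -/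

section IndexSets

variable {r k : ℕ}

/-- Pigeonhole: if `H s < I s`, then `σ` would map the indices up to `s` injectively into those
below `s`. Hence domination in any order implies domination of the sorted lists. -/
theorem indexLE_of_perm {I H : Fin k ↪o Fin r} (σ : Equiv.Perm (Fin k))
    (h : ∀ s, I (σ s) ≤ H s) : IndexLE I H := by
  intro s
  by_contra! hs
  have h1 : ((Finset.Iic s).map σ.toEmbedding) ⊆ Finset.Iio s := by
    intro t ht
    obtain ⟨u, hu, rfl⟩ := Finset.mem_map.1 ht
    exact Finset.mem_Iio.2 (I.lt_iff_lt.1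
      (((h u).trans (H.monotone (Finset.mem_Iic.1 hu))).trans_lt hs))
  have h2 := Finset.card_le_card h1
  simp at h2

theorem indexLE_lastColumns (h : k ≤ r) (I : Fin k ↪o Fin r) : IndexLE I (lastColumns h) := by
  intro s
  have h1 : ((Finset.Ioi s).map I.toEmbedding) ⊆ Finset.Ioi (I s) := by
    intro t ht
    obtain ⟨u, hu, rfl⟩ := Finset.mem_map.1 ht
    exact Finset.mem_Ioi.2 (I.lt_iff_lt.2 (Finset.mem_Ioi.1 hu))
  have h2 := Finset.card_le_card h1
  simp only [Finset.card_map, Fin.card_Ioi] at h2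
  refine Fin.le_def.2 ?_
  change (I s).val ≤ r - k + s.val
  omega

theorem mem_range_lastColumns (h : k ≤ r) (c : Fin r) :
    c ∈ Set.range (lastColumns h) ↔ r - k ≤ c.val := by
  constructor
  · rintro ⟨s, rfl⟩
    exact Nat.le_add_right _ _
  · intro hc
    exact ⟨⟨c.val - (r - k), by omega⟩, Fin.ext (by change r - k + (c.val - (r - k)) = _; omega)⟩

/-- Minors of an upper triangular matrix vanish unless the rows lie before the columns. -/
theorem minorIJ_eq_zero_of_not_indexLE {A : Type*} [CommRing A] {W : Matrix (Fin r) (Fin r) A}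
    (hW : W.IsUpperTriangular) {I H : Fin k ↪o Fin r} (h : ¬ IndexLE I H) :
    W.minorIJ I H = 0 := by
  rw [Matrix.minorIJ, Matrix.det_apply]
  refine Finset.sum_eq_zero fun σ _ => ?_
  obtain ⟨s, hs⟩ : ∃ s, H s < I (σ s) := by
    by_contra! h'
    exact h (indexLE_of_perm σ h')
  rw [Finset.prod_eq_zero (Finset.mem_univ s) (hW hs), smul_zero]

theorem sum_orderEmbOfFin {M : Type*} [AddCommMonoid M] (X : Finset (Fin r)) (f : Fin r → M) :
    ∑ s, f (X.orderEmbOfFin rfl s) = ∑ x ∈ X, f x := by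
  conv_rhs => rw [← X.map_orderEmbOfFin_univ rfl, Finset.sum_map]
  rfl

/-- Replacing an element of an index set by a larger one makes the index set larger. -/
theorem indexLE_insert {C : Finset (Fin r)} {a b : Fin r} (ha : a ∉ C) (hb : b ∉ C) (hab : a ≤ b)
    (h₁ : (insert a C).card = k) (h₂ : (insert b C).card = k) :
    IndexLE ((insert a C).orderEmbOfFin h₁) ((insert b C).orderEmbOfFin h₂) := by
  -- The swap carries `insert b C` into `insert a C` without raising any element; `indexLE_of_perm`
  -- takes care of the sorting.
  let φ : Fin r → Fin r := Equiv.swap a b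
  have hφ : ∀ s, φ ((insert b C).orderEmbOfFin h₂ s) ∈ insert a C := by
    intro s
    rcases Finset.mem_insert.1 ((insert b C).orderEmbOfFin_mem h₂ s) with h | h
    · rw [h]; simp [φ]
    · rw [show φ _ = _ from Equiv.swap_apply_of_ne_of_ne (fun e => ha (e ▸ h)) (fun e => hb (e ▸ h))]
      exact Finset.mem_insert_of_mem h
  have hle : ∀ s, φ ((insert b C).orderEmbOfFin h₂ s) ≤ (insert b C).orderEmbOfFin h₂ s := by
    intro s
    rcases Finset.mem_insert.1 ((insert b C).orderEmbOfFin_mem h₂ s) with h | h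
    · rw [h]; simpa [φ] using hab
    · rw [show φ _ = _ from Equiv.swap_apply_of_ne_of_ne (fun e => ha (e ▸ h)) (fun e => hb (e ▸ h))]
  have hex : ∀ s, ∃ t, (insert a C).orderEmbOfFin h₁ t = φ ((insert b C).orderEmbOfFin h₂ s) := by
    intro s
    have : φ ((insert b C).orderEmbOfFin h₂ s) ∈ Set.range ((insert a C).orderEmbOfFin h₁) := by
      rw [Finset.range_orderEmbOfFin]; exact hφ s
    exact this
  choose τ hτ using hex
  have hinj : τ.Injective := fun s t hst => by
    have h := (hτ s).symm.trans ((congrArg _ hst).trans (hτ t))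
    exact ((insert b C).orderEmbOfFin h₂).injective ((Equiv.swap a b).injective h)
  refine indexLE_of_perm (Equiv.ofBijective τ (Finite.injective_iff_bijective.1 hinj)) fun s => ?_
  rw [Equiv.ofBijective_apply, hτ]
  exact hle s

end IndexSets

/-! ### Minors on the right-most columns. -/

section RowMinors

variable {K : Type*} [Field K] {r : ℕ}

theorem card_le_of_finset (X : Finset (Fin r)) : X.card ≤ r := by simpa using X.card_le_univ

/-- The minor of `W` with rows `X`, using the right-most columns. -/
def rowMinor {A : Type*} [CommRing A] (W : Matrix (Fin r) (Fin r) A) (X : Finset (Fin r)) : A :=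
  W.minorIJ (X.orderEmbOfFin rfl) (lastColumns (card_le_of_finset X))

/-- The order of the minor of `W` with rows `X`, using the right-most columns. -/
def rowOrd (W : Matrix (Fin r) (Fin r) (SeriesField K)) (X : Finset (Fin r)) : ℝ :=
  realOrd (rowMinor W X)

theorem omittedOrder_eq (W : Matrix (Fin r) (Fin r) (SeriesField K)) (p q : ℕ) :
    omittedOrder W p q = rowOrd W (omittedRows r p q) := rfl

theorem rowMinor_eq_minorIJ {A : Type*} [CommRing A] {k : ℕ} (W : Matrix (Fin r) (Fin r) A)
    (X : Finset (Fin r)) (h : X.card = k) (hk : k ≤ r) :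
    rowMinor W X = W.minorIJ (X.orderEmbOfFin h) (lastColumns hk) := by
  subst h; rfl

theorem injective_elim_one {k : ℕ} (τ : Fin k ↪o Fin r) (x : Fin r) (hx : x ∉ Set.range τ) :
    (Sum.elim ![x] τ).Injective :=
  (Function.injective_of_subsingleton _).sumElim τ.injective
    fun i s h => hx ⟨s, by rw [← h]; fin_cases i; rfl⟩

theorem injective_elim_two {k : ℕ} (τ : Fin k ↪o Fin r) (x y : Fin r) (hxy : x ≠ y)
    (hx : x ∉ Set.range τ) (hy : y ∉ Set.range τ) : (Sum.elim ![x, y] τ).Injective := by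
  refine Function.Injective.sumElim ?_ τ.injective ?_
  · intro i j hij
    fin_cases i <;> fin_cases j
    · rfl
    · exact absurd hij hxy
    · exact absurd hij.symm hxy
    · rfl
  · intro i s h
    fin_cases i
    · exact hx ⟨s, h.symm⟩
    · exact hy ⟨s, h.symm⟩

theorem mem_range_elim_one {k : ℕ} (τ : Fin k ↪o Fin r) (x z : Fin r) :
    z ∈ Set.range (Sum.elim ![x] τ) ↔ z = x ∨ z ∈ Set.range τ := by
  rw [Set.Sum.elim_range, Set.mem_union, Matrix.range_cons, Matrix.range_empty, Set.union_empty,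
    Set.mem_singleton_iff]

theorem mem_range_elim_two {k : ℕ} (τ : Fin k ↪o Fin r) (x y z : Fin r) :
    z ∈ Set.range (Sum.elim ![x, y] τ) ↔ z = x ∨ z = y ∨ z ∈ Set.range τ := by
  rw [Set.Sum.elim_range, Set.mem_union, Matrix.range_cons, Matrix.range_cons, Matrix.range_empty,
    Set.union_empty, Set.mem_union, Set.mem_singleton_iff, Set.mem_singleton_iff, or_assoc]

/-- The minors with rows `C ∪ {x}` and `C ∪ {x, y}` in terms of two functions on the rows. The
columns used are the right-most ones; `A' x` comes from the other columns containing the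
right-most `|C|` ones. -/
theorem exists_bordered (W : Matrix (Fin r) (Fin r) (SeriesField K)) (C : Finset (Fin r))
    (hC : rowMinor W C ≠ 0) (hcard : C.card + 2 ≤ r) :
    ∃ A A' : Fin r → SeriesField K,
      (∀ x ∉ C, ord (A x) = ord (rowMinor W (insert x C))) ∧
      (∀ x ∉ C, ∃ H : Fin (insert x C).card ↪o Fin r,
        ord (A' x) = ord (W.minorIJ ((insert x C).orderEmbOfFin rfl) H)) ∧
      ∀ x y, x ∉ C → y ∉ C → x ≠ y → ord (A' x * A y - A x * A' y) =
        ord (rowMinor W C) + ord (rowMinor W (insert x (insert y C))) := by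
  set L := lastColumns (card_le_of_finset C) with hL
  set ρ := C.orderEmbOfFin rfl with hρ
  obtain ⟨S, hS⟩ := exists_det_bordered W ρ L hC
  -- `c` and `d` are the two columns just left of the last `|C|` columns, so adjoining `d`, or both,
  -- again yields right-most columns.
  let c : Fin r := ⟨r - C.card - 2, by omega⟩
  let d : Fin r := ⟨r - C.card - 1, by omega⟩
  have hLr : ∀ z, z ∈ Set.range L ↔ r - C.card ≤ z.val := mem_range_lastColumns _
  have hc : c ∉ Set.range L := by rw [hLr]; simp only [c]; omega
  have hd : d ∉ Set.range L := by rw [hLr]; simp only [d]; omega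
  have hcd : c ≠ d := by simp only [c, d, ne_eq, Fin.mk.injEq]; omega
  have hρr : Set.range ρ = C := Finset.range_orderEmbOfFin _ _
  have hρ' : ∀ x ∉ C, x ∉ Set.range ρ := fun x hx => by rwa [hρr]
  have key1 : ∀ x ∉ C, ∀ e, (W.submatrix (Sum.elim ![x] ρ) (Sum.elim ![e] L)).det =
      rowMinor W C * S x e := fun x _ e => by
    rw [hS 1 ![x] ![e], Matrix.det_fin_one]; rfl
  refine ⟨fun x => rowMinor W C * S x d, fun x => rowMinor W C * S x c, fun x hx => ?_,
    fun x hx => ?_, fun x y hx hy hxy => ?_⟩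
  · dsimp only
    rw [← key1 x hx d]
    refine ord_det_submatrix_congr W (injective_elim_one ρ x (hρ' x hx)) (injective_elim_one L d hd)
      (RelEmbedding.injective _) (RelEmbedding.injective _) ?_ ?_
    · ext z
      rw [mem_range_elim_one, hρr, Finset.range_orderEmbOfFin]; simp
    · ext z
      rw [mem_range_elim_one, hLr, mem_range_lastColumns, Finset.card_insert_of_notMem hx, Fin.ext_iff]
      simp only [d]; omega
  · have hY : (insert c (Finset.univ.map L.toEmbedding)).card = (insert x C).card := by
      rw [Finset.card_insert_of_notMem hx, Finset.card_insert_of_notMem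
        fun h => hc (by simpa using h)]
      simp
    refine ⟨(insert c (Finset.univ.map L.toEmbedding)).orderEmbOfFin hY, ?_⟩
    dsimp only
    rw [← key1 x hx c]
    refine ord_det_submatrix_congr W (injective_elim_one ρ x (hρ' x hx)) (injective_elim_one L c hc)
      (RelEmbedding.injective _) (RelEmbedding.injective _) ?_ ?_
    · ext z
      rw [mem_range_elim_one, hρr, Finset.range_orderEmbOfFin]; simp
    · ext z
      rw [mem_range_elim_one, Finset.range_orderEmbOfFin]; simp
  · have h2 : ord (W.submatrix (Sum.elim ![x, y] ρ) (Sum.elim ![c, d] L)).det =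
        ord (rowMinor W (insert x (insert y C))) := by
      refine ord_det_submatrix_congr W (injective_elim_two ρ x y hxy (hρ' x hx) (hρ' y hy))
        (injective_elim_two L c d hcd hc hd) (RelEmbedding.injective _) (RelEmbedding.injective _) ?_ ?_
      · ext z
        rw [mem_range_elim_two, hρr, Finset.range_orderEmbOfFin]; simp
      · ext z
        rw [mem_range_elim_two, hLr, mem_range_lastColumns, Finset.card_insert_of_notMem (by simp [hxy, hx]),
          Finset.card_insert_of_notMem hy, Fin.ext_iff, Fin.ext_iff]
        simp only [c, d]; omega
    rw [← h2, hS 2 ![x, y] ![c, d], Matrix.det_fin_two, ← ord_mul]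
    change ord _ = ord (rowMinor W C * (rowMinor W C * _))
    congr 1
    simp only [Matrix.submatrix_apply, Matrix.cons_val_zero, Matrix.cons_val_one]
    ring

end RowMinors

/-! ### Inequalities between the minors of a generic matrix. -/

section Generic

variable {K : Type*} [Field K] {r : ℕ} {μ : Fin r → ℝ}
  {N W : Matrix.GeneralLinearGroup (Fin r) (SeriesField K)}

theorem isUpperTriangular_apply_ne_zero {F : Type*} [Field F]
    {W : Matrix.GeneralLinearGroup (Fin r) F} (h : W.val.IsUpperTriangular) (i : Fin r) :
    W.val i i ≠ 0 := by
  have h1 : W.val.det ≠ 0 := (Matrix.isUnit_iff_isUnit_det _).1 W.isUnit |>.ne_zero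
  rw [Matrix.det_of_isUpperTriangular h] at h1
  exact Finset.prod_ne_zero_iff.1 h1 i (Finset.mem_univ i)

namespace IsMuGeneric

theorem minorIJ_lastColumns_ne_zero (hW : IsMuGeneric μ N W) {k : ℕ} (hk : k ≤ r)
    (I : Fin k ↪o Fin r) : W.val.minorIJ I (lastColumns hk) ≠ 0 := by
  have h1 := hW.row_le k I _ _ (indexLE_lastColumns hk I) (fun s => le_rfl)
  intro h0
  rw [h0, ord_zero, top_le_iff, ord_eq_top_iff, Matrix.minorIJ, Matrix.det_of_isUpperTriangular]
    at h1
  · obtain ⟨s, _, hs⟩ := Finset.prod_eq_zero_iff.1 h1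
    exact isUpperTriangular_apply_ne_zero hW.upper _ hs
  · intro s t hst
    exact hW.upper ((lastColumns hk).lt_iff_lt.2 hst)

theorem rowMinor_ne_zero (hW : IsMuGeneric μ N W) (X : Finset (Fin r)) :
    rowMinor W.val X ≠ 0 := hW.minorIJ_lastColumns_ne_zero _ _

theorem coe_rowOrd (hW : IsMuGeneric μ N W) (X : Finset (Fin r)) :
    (rowOrd W.val X : WithTop ℝ) = ord (rowMinor W.val X) := coe_realOrd (hW.rowMinor_ne_zero X)

/-- Among minors with given rows, the right-most columns minimise the order: `col_le` covers `I ⊆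
H`, and otherwise triangularity makes the minor zero. -/
theorem ord_minorIJ_lastColumns_le (hW : IsMuGeneric μ N W) {k : ℕ} (hk : k ≤ r)
    (I H : Fin k ↪o Fin r) :
    ord (W.val.minorIJ I (lastColumns hk)) ≤ ord (W.val.minorIJ I H) := by
  by_cases h : IndexLE I H
  · exact hW.col_le k I H _ h (indexLE_lastColumns hk H)
  · rw [minorIJ_eq_zero_of_not_indexLE hW.upper h, ord_zero]
    exact le_top

theorem rowOrd_insert_le (hW : IsMuGeneric μ N W) {C : Finset (Fin r)} {a b : Fin r}
    (ha : a ∉ C) (hb : b ∉ C) (hab : a ≤ b) :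
    rowOrd W.val (insert a C) ≤ rowOrd W.val (insert b C) := by
  have h₂ : (insert b C).card = (insert a C).card := by
    rw [Finset.card_insert_of_notMem ha, Finset.card_insert_of_notMem hb]
  rw [← WithTop.coe_le_coe, hW.coe_rowOrd, hW.coe_rowOrd,
    rowMinor_eq_minorIJ _ (insert b C) h₂ (card_le_of_finset _)]
  exact hW.row_le _ _ _ _ (indexLE_insert ha hb hab rfl h₂) (indexLE_lastColumns _ _)

theorem rowOrd_insert_le_add (hW : IsMuGeneric μ N W) {C : Finset (Fin r)} {a b : Fin r}
    (ha : a ∉ C) (hb : b ∉ C) (hab : a ≤ b) :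
    rowOrd W.val (insert b C) ≤ rowOrd W.val (insert a C) + (μ a - μ b) := by
  have h₂ : (insert b C).card = (insert a C).card := by
    rw [Finset.card_insert_of_notMem ha, Finset.card_insert_of_notMem hb]
  have h := hW.gap_le _ _ _ _ (indexLE_insert ha hb hab rfl h₂)
    (indexLE_lastColumns (card_le_of_finset _) _)
  have h3 : ∑ s, μ ((insert b C).orderEmbOfFin h₂ s) = ∑ x ∈ insert b C, μ x := by
    conv_rhs => rw [← (insert b C).map_orderEmbOfFin_univ h₂, Finset.sum_map]
    rfl
  rw [← rowMinor_eq_minorIJ _ (insert b C) h₂, sum_orderEmbOfFin, h3,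
    Finset.sum_insert ha, Finset.sum_insert hb, add_sub_add_right_eq_sub] at h
  rw [← WithTop.coe_le_coe, hW.coe_rowOrd, WithTop.coe_add, hW.coe_rowOrd]
  exact h

theorem card_add_two_le {C : Finset (Fin r)} {x y : Fin r} (hx : x ∉ C) (hy : y ∉ C)
    (hxy : x ≠ y) : C.card + 2 ≤ r := by
  have h := card_le_of_finset (insert x (insert y C))
  rwa [Finset.card_insert_of_notMem (by simp [hxy, hx]), Finset.card_insert_of_notMem hy] at h

/-- The tropical form of the three-term Plücker relation. -/
theorem min_rowOrd_le (hW : IsMuGeneric μ N W) {C : Finset (Fin r)} {x y z : Fin r}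
    (hx : x ∉ C) (hy : y ∉ C) (hz : z ∉ C) (hxy : x ≠ y) (hxz : x ≠ z) (hyz : y ≠ z) :
    min (rowOrd W.val (insert y C) + rowOrd W.val (insert x (insert z C)))
        (rowOrd W.val (insert z C) + rowOrd W.val (insert x (insert y C))) ≤
      rowOrd W.val (insert x C) + rowOrd W.val (insert y (insert z C)) := by
  obtain ⟨A, A', hA, -, hP⟩ := exists_bordered W.val C (hW.rowMinor_ne_zero C)
    (card_add_two_le hx hy hxy)
  -- The products `A x * A y * A' z` and their permutations cancel. Each bracket is a two-row
  -- bordered minor times the minor on `C`, so `[C]` drops out of the inequality.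
  have h : A x * (A' y * A z - A y * A' z) =
      A y * (A' x * A z - A x * A' z) - A z * (A' x * A y - A x * A' y) := by ring
  have h1 := min_ord_le_ord_sub (A y * (A' x * A z - A x * A' z)) (A z * (A' x * A y - A x * A' y))
  rw [← h, ord_mul, ord_mul, ord_mul, hP _ _ hy hz hyz, hP _ _ hx hz hxz, hP _ _ hx hy hxy,
    hA x hx, hA y hy, hA z hz] at h1
  simp only [← hW.coe_rowOrd, ← WithTop.coe_add, ← WithTop.coe_min, WithTop.coe_le_coe] at h1
  rw [min_le_iff] at h1 ⊢
  rcases h1 with h1 | h1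
  · left; linarith
  · right; linarith

/-- In the Sylvester identity for `C`, `x`, `y`, each product on the other side pairs a minor on the
right-most columns with one on the same rows as its counterpart but other columns, whose order is no
smaller by `col_le`. -/
theorem rowOrd_insert_add_le (hW : IsMuGeneric μ N W) {C : Finset (Fin r)} {x y : Fin r}
    (hx : x ∉ C) (hy : y ∉ C) (hxy : x ≠ y) :
    rowOrd W.val (insert x C) + rowOrd W.val (insert y C) ≤
      rowOrd W.val C + rowOrd W.val (insert x (insert y C)) := by
  obtain ⟨A, A', hA, hA', hP⟩ := exists_bordered W.val C (hW.rowMinor_ne_zero C)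
    (card_add_two_le hx hy hxy)
  have hle : ∀ x ∉ C, (rowOrd W.val (insert x C) : WithTop ℝ) ≤ ord (A' x) := fun x hx => by
    obtain ⟨H, hH⟩ := hA' x hx
    rw [hH, hW.coe_rowOrd]
    exact hW.ord_minorIJ_lastColumns_le _ _ H
  have h1 := min_ord_le_ord_sub (A' x * A y) (A x * A' y)
  rw [hP x y hx hy hxy, ord_mul, ord_mul, hA x hx, hA y hy] at h1
  simp only [← hW.coe_rowOrd] at h1
  rw [← WithTop.coe_le_coe, WithTop.coe_add, WithTop.coe_add]
  exact (le_min (add_le_add_left (hle x hx) _) (add_le_add_right (hle y hy) _)).trans h1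

end IsMuGeneric

end Generic

/-! ### Invariant partitions and least orders of minors. -/

section InvariantPartition

variable {K : Type*} [Field K] {r : ℕ} {μ ν : Fin r → ℝ}

theorem ord_nonneg_of_mem_integralGL {P : Matrix.GeneralLinearGroup (Fin r) (SeriesField K)}
    (hP : P ∈ integralGL K r) (i j : Fin r) : 0 ≤ ord (P.val i j) := by
  obtain ⟨G, rfl⟩ := hP
  exact (G.val i j).2

/-- A lower bound for the orders of the minors of a given size also holds after multiplication by
integral matrices. -/
theorem le_ord_det_submatrix_mul_mul {ι : Type*} [Fintype ι] [DecidableEq ι] {c : WithTop ℝ}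
    {A P Q : Matrix (Fin r) (Fin r) (SeriesField K)} (hP : ∀ i j, 0 ≤ ord (P i j))
    (hQ : ∀ i j, 0 ≤ ord (Q i j)) (h : ∀ f g : ι → Fin r, c ≤ ord (A.submatrix f g).det)
    (f g : ι → Fin r) : c ≤ ord ((P * A * Q).submatrix f g).det := by
  rw [← Matrix.det_transpose, Matrix.transpose_submatrix, Matrix.transpose_mul]
  refine le_ord_det_submatrix_mul _ (fun i j => hQ j i) _ f (fun g => ?_) g
  rw [← Matrix.transpose_submatrix, Matrix.det_transpose]
  exact le_ord_det_submatrix_mul P hP A g (fun f => h f g) f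

/-- Passes from increasing index sets to the arbitrary functions needed in
`le_ord_det_submatrix_mul`: a repetition makes the determinant zero, and sorting changes only its
sign. -/
theorem le_ord_det_submatrix_of_minorIJ {k : ℕ} {c : WithTop ℝ}
    {A : Matrix (Fin r) (Fin r) (SeriesField K)}
    (h : ∀ I J : Fin k ↪o Fin r, c ≤ ord (A.minorIJ I J)) (f g : Fin k → Fin r) :
    c ≤ ord (A.submatrix f g).det := by
  by_cases hf : f.Injective
  · by_cases hg : g.Injective
    · have hX : (Finset.univ.image f).card = k := by simp [Finset.card_image_of_injective _ hf]
      have hY : (Finset.univ.image g).card = k := by simp [Finset.card_image_of_injective _ hg]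
      refine (h (Finset.orderEmbOfFin _ hX) (Finset.orderEmbOfFin _ hY)).trans_eq ?_
      refine (ord_det_submatrix_congr A hf hg (RelEmbedding.injective _)
        (RelEmbedding.injective _) ?_ ?_).symm
      · rw [Finset.range_orderEmbOfFin]; simp
      · rw [Finset.range_orderEmbOfFin]; simp
    · obtain ⟨s, t, hst, hne⟩ := by simpa [Function.Injective] using hg
      rw [Matrix.det_zero_of_column_eq hne fun i => by simp [hst], ord_zero]
      exact le_top
  · obtain ⟨s, t, hst, hne⟩ := by simpa [Function.Injective] using hf
    rw [Matrix.det_zero_of_row_eq hne (by ext; simp [hst]), ord_zero]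
    exact le_top

/-- A nonzero Leibniz term has order `∑ μ (J s)`, and `J s` lies weakly before the `s`-th of the
last `k` indices, where `μ` is smallest. -/
theorem sum_le_ord_minorIJ_diagT (hμ : Antitone μ) {k : ℕ} (hk : k ≤ r) (I J : Fin k ↪o Fin r) :
    ((∑ s, μ (lastColumns hk s) : ℝ) : WithTop ℝ) ≤ ord ((diagT K μ).val.minorIJ I J) := by
  rw [Matrix.minorIJ, Matrix.det_apply]
  refine le_ord_sum fun σ _ => ?_
  rw [ord_sign_smul, ord_prod, WithTop.coe_sum]
  refine Finset.sum_le_sum fun s _ => ?_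
  change _ ≤ ord (Matrix.diagonal (fun i => tPow (μ i)) (I (σ s)) (J s))
  rw [Matrix.diagonal_apply]
  split_ifs with h
  · rw [ord_tPow, h]
    exact WithTop.coe_le_coe.2 (hμ (indexLE_lastColumns hk J s))
  · rw [ord_zero]; exact le_top

theorem ord_minorIJ_diagT_lastColumns {k : ℕ} (hk : k ≤ r) :
    ord ((diagT K μ).val.minorIJ (lastColumns hk) (lastColumns hk)) =
      ((∑ s, μ (lastColumns hk s) : ℝ) : WithTop ℝ) := by
  change ord ((Matrix.diagonal (fun i => tPow (μ i))).submatrix _ _).det = _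
  rw [Matrix.submatrix_diagonal _ _ (RelEmbedding.injective _), Matrix.det_diagonal, ord_prod,
    WithTop.coe_sum]
  exact Finset.sum_congr rfl fun s _ => ord_tPow _

namespace IsInvariantPartition

variable {A P Q : Matrix.GeneralLinearGroup (Fin r) (SeriesField K)}

theorem mul_mul_inv (h : IsInvariantPartition A μ) (hP : P ∈ integralGL K r)
    (hQ : Q ∈ integralGL K r) : IsInvariantPartition (P * A * Q⁻¹) μ := by
  obtain ⟨hμ, P₀, hP₀, Q₀, hQ₀, h0⟩ := h
  refine ⟨hμ, P₀ * P⁻¹, mul_mem hP₀ (inv_mem hP), Q₀ * Q⁻¹, mul_mem hQ₀ (inv_mem hQ), ?_⟩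
  rw [← h0]; group

/-- The sum of the `k` smallest parts is a lower bound for the orders of the `k × k` minors. -/
theorem sum_le_ord_minorIJ (h : IsInvariantPartition A μ) {k : ℕ} (hk : k ≤ r)
    (I J : Fin k ↪o Fin r) :
    ((∑ s, μ (lastColumns hk s) : ℝ) : WithTop ℝ) ≤ ord (A.val.minorIJ I J) := by
  obtain ⟨hμ, P, hP, Q, hQ, h0⟩ := h
  have hA : A = P⁻¹ * diagT K μ * Q := by rw [← h0]; group
  rw [hA]
  exact le_ord_det_submatrix_mul_mul (ord_nonneg_of_mem_integralGL (inv_mem hP))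
    (ord_nonneg_of_mem_integralGL hQ)
    (le_ord_det_submatrix_of_minorIJ (sum_le_ord_minorIJ_diagT hμ hk)) I J

/-- The sum of the `k` smallest parts is the largest lower bound for the orders of the `k × k`
minors. -/
theorem le_sum_of_le_ord_minorIJ (h : IsInvariantPartition A μ) {k : ℕ} (hk : k ≤ r)
    {c : WithTop ℝ} (hc : ∀ I J : Fin k ↪o Fin r, c ≤ ord (A.val.minorIJ I J)) :
    c ≤ ((∑ s, μ (lastColumns hk s) : ℝ) : WithTop ℝ) := by
  obtain ⟨hμ, P, hP, Q, hQ, h0⟩ := h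
  rw [← ord_minorIJ_diagT_lastColumns (K := K), ← h0]
  exact le_ord_det_submatrix_mul_mul (ord_nonneg_of_mem_integralGL hP)
    (ord_nonneg_of_mem_integralGL (inv_mem hQ)) (le_ord_det_submatrix_of_minorIJ hc) _ _

end IsInvariantPartition

theorem ord_minorIJ_diagT_mul (A : Matrix.GeneralLinearGroup (Fin r) (SeriesField K)) {k : ℕ}
    (I J : Fin k ↪o Fin r) : ord ((diagT K μ * A).val.minorIJ I J) =
      ((∑ s, μ (I s) : ℝ) : WithTop ℝ) + ord (A.val.minorIJ I J) := by
  have h : (diagT K μ * A).val.submatrix I J =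
      Matrix.of fun s t => tPow (μ (I s)) * A.val.submatrix I J s t := by
    ext1 s t
    exact Matrix.diagonal_mul (fun i => tPow (μ i)) A.val (I s) (J t)
  rw [Matrix.minorIJ, h, Matrix.det_mul_column, ord_mul, ord_prod, WithTop.coe_sum]
  exact congrArg (· + _) (Finset.sum_congr rfl fun s _ => ord_tPow _)

end InvariantPartition

/-! ### Combinatorics of omitted intervals of rows. -/

section OmittedRows

variable {r : ℕ}

theorem mem_omittedRows {p q : ℕ} {x : Fin r} :
    x ∈ omittedRows r p q ↔ ¬ (p ≤ x.val + 1 ∧ x.val + 1 ≤ q) := by simp [omittedRows]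

theorem card_omittedRows {p q : ℕ} (hp : 1 ≤ p) (hq : q ≤ r) :
    (omittedRows r p q).card = r - (q + 1 - p) := by
  have h : (omittedRows r p q).map Fin.valEmbedding = Finset.range r \ Finset.Ico (p - 1) q := by
    ext x
    simp only [Finset.mem_map, mem_omittedRows, Fin.valEmbedding_apply, Finset.mem_sdiff,
      Finset.mem_range, Finset.mem_Ico]
    constructor
    · rintro ⟨y, hy, rfl⟩
      omega
    · rintro ⟨h1, h2⟩
      exact ⟨⟨x, h1⟩, by simp only; omega, rfl⟩
  rw [← Finset.card_map Fin.valEmbedding, h, Finset.card_sdiff_of_subset, Finset.card_range,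
    Nat.card_Ico]
  · congr 1; omega
  · intro x hx
    simp only [Finset.mem_Ico, Finset.mem_range] at hx ⊢
    omega

theorem orderEmbOfFin_omittedRows_one {k q : ℕ} (hq : q ≤ r) (hk : k ≤ r)
    (h : (omittedRows r 1 q).card = k) :
    (omittedRows r 1 q).orderEmbOfFin h = lastColumns hk := by
  refine (Finset.orderEmbOfFin_unique' _ fun s => mem_omittedRows.2 ?_).symm
  rw [card_omittedRows le_rfl hq] at h
  change ¬ (_ ∧ r - k + s.val + 1 ≤ q)
  omega

theorem indexLE_omittedRows_top {k p : ℕ} (hp : 1 ≤ p) (hpr : p ≤ r + 1)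
    (h : (omittedRows r p r).card = k) (I : Fin k ↪o Fin r) :
    IndexLE ((omittedRows r p r).orderEmbOfFin h) I := by
  have hk : k ≤ r := h ▸ card_le_of_finset _
  have h1 : (omittedRows r p r).orderEmbOfFin h = Fin.castLEOrderEmb hk := by
    refine (Finset.orderEmbOfFin_unique' _ fun s => mem_omittedRows.2 ?_).symm
    rw [card_omittedRows hp le_rfl] at h
    change ¬ (p ≤ s.val + 1 ∧ s.val + 1 ≤ r)
    omega
  intro s
  have h2 : ((Finset.Iio s).map I.toEmbedding) ⊆ Finset.Iio (I s) := by
    intro t ht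
    obtain ⟨u, hu, rfl⟩ := Finset.mem_map.1 ht
    exact Finset.mem_Iio.2 (I.lt_iff_lt.2 (Finset.mem_Iio.1 hu))
  have h3 := Finset.card_le_card h2
  rw [h1]
  exact Fin.le_def.2 (by simpa using h3)

/-- Shortening the omitted interval at an end restores one row, so the minors in each condition
become `C` plus at most two rows. The zero-based row `q` has one-based number `q + 1`. -/
theorem insert_omittedRows_right {p q : ℕ} (x : Fin r) (hx : x.val = q) :
    insert x (omittedRows r p (q + 1)) = omittedRows r p q := by
  ext y
  simp only [Finset.mem_insert, mem_omittedRows, Fin.ext_iff]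
  omega

theorem insert_omittedRows_left {p q : ℕ} (x : Fin r) (hx : x.val + 1 = p) :
    insert x (omittedRows r p q) = omittedRows r (p + 1) q := by
  ext y
  simp only [Finset.mem_insert, mem_omittedRows, Fin.ext_iff]
  omega

theorem omittedRows_eq_univ {p q : ℕ} (h : q < p) : omittedRows r p q = Finset.univ := by
  ext y
  simp only [mem_omittedRows, Finset.mem_univ, iff_true]
  omega

/-- Needed for the diagonal parts `k_jj`, where `p = j - i` is `0`. -/
theorem omittedRows_zero (q : ℕ) : omittedRows r 0 q = omittedRows r 1 q := by
  ext y
  simp only [mem_omittedRows]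
  omega

end OmittedRows

/-! ### Corner minors give `λ` and `ν`. -/

namespace IsMuGeneric

variable {K : Type*} [Field K] {r : ℕ} {μ ν lam : Fin r → ℝ}
  {N W : Matrix.GeneralLinearGroup (Fin r) (SeriesField K)}

theorem rowOrd_omittedRows_one (hW : IsMuGeneric μ N W)
    (hlam : IsInvariantPartition (diagT K μ * W) lam) {q : ℕ} (hq : q ≤ r) :
    ∑ x ∈ omittedRows r 1 q, μ x + rowOrd W.val (omittedRows r 1 q) =
      ∑ x ∈ omittedRows r 1 q, lam x := by
  set X := omittedRows r 1 q
  have hk := card_le_of_finset X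
  have hL : X.orderEmbOfFin rfl = lastColumns hk := orderEmbOfFin_omittedRows_one hq hk rfl
  have hmin : rowMinor W.val X = W.val.minorIJ (lastColumns hk) (lastColumns hk) := by
    rw [rowMinor, hL]
  rw [← sum_orderEmbOfFin X μ, ← sum_orderEmbOfFin X lam, hL, ← WithTop.coe_inj, WithTop.coe_add,
    hW.coe_rowOrd, hmin]
  apply le_antisymm
  -- Every minor of `D_μ N*` has order at least that of the lower right corner: move to the last
  -- columns by `col_le`, then to the last rows by `gap_le`, whose term `|μ_I| - |μ_H|` absorbs the
  -- factor `D_μ`.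
  · refine hlam.le_sum_of_le_ord_minorIJ hk fun I J => ?_
    rw [ord_minorIJ_diagT_mul]
    refine le_trans ?_ (add_le_add_right (hW.ord_minorIJ_lastColumns_le hk I J) _)
    have h := hW.gap_le _ I _ _ (indexLE_lastColumns hk I) fun s => le_rfl
    refine (add_le_add_right h _).trans_eq ?_
    rw [add_left_comm, ← WithTop.coe_add, add_sub_cancel, add_comm]
  · rw [← ord_minorIJ_diagT_mul]
    exact hlam.sum_le_ord_minorIJ hk _ _

theorem rowOrd_omittedRows_top (hW : IsMuGeneric μ N W) (hν : IsInvariantPartition W ν) {q : ℕ}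
    (hq : q ≤ r) :
    rowOrd W.val (omittedRows r (r - q + 1) r) = ∑ x ∈ omittedRows r 1 q, ν x := by
  have hX := card_omittedRows (p := 1) le_rfl hq
  have hY := card_omittedRows (r := r) (p := r - q + 1) (q := r) (by omega) le_rfl
  have hk : r - q ≤ r := Nat.sub_le _ _
  have hX' : (omittedRows r 1 q).card = r - q := by omega
  have hY' : (omittedRows r (r - q + 1) r).card = r - q := by omega
  have hsum : ∑ x ∈ omittedRows r 1 q, ν x = ∑ s, ν (lastColumns hk s) := by
    rw [← orderEmbOfFin_omittedRows_one hq hk hX']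
    conv_lhs => rw [← (omittedRows r 1 q).map_orderEmbOfFin_univ hX', Finset.sum_map]
    rfl
  rw [hsum, ← WithTop.coe_inj, hW.coe_rowOrd, rowMinor_eq_minorIJ _ _ hY' hk]
  apply le_antisymm
  -- The upper right corner has the least order: its rows precede all others and its columns follow
  -- all others.
  · refine hν.le_sum_of_le_ord_minorIJ hk fun I J => ?_
    exact (hW.row_le _ _ _ _ (indexLE_omittedRows_top (by omega) (by omega) hY' I)
      (indexLE_lastColumns hk I)).trans (hW.ord_minorIJ_lastColumns_le hk I J)
  · exact hν.sum_le_ord_minorIJ hk _ _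

end IsMuGeneric

/-! ### Telescoping sums of the array. -/

section FillingPart

variable {K : Type*} [Field K] {r : ℕ} (W : Matrix (Fin r) (Fin r) (SeriesField K))

theorem sum_range_fillingPart (n j : ℕ) :
    ∑ s ∈ Finset.range n, (partialPart W (s + 1) (j + 1) - partialPart W s (j + 1)) =
      partialPart W n (j + 1) := by
  have h : partialPart W 0 (j + 1) = 0 := by
    rw [partialPart, omittedOrder_eq, omittedOrder_eq, omittedRows_eq_univ (by omega),
      omittedRows_eq_univ (by omega), sub_self]
  rw [Finset.sum_range_sub fun s => partialPart W s (j + 1), h, sub_zero]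

theorem sum_Iic_fillingPart (i j : Fin r) :
    ∑ s ∈ Finset.Iic i, fillingPart W s j = partialPart W (i.val + 1) (j.val + 1) := by
  rw [← sum_range_fillingPart W (i.val + 1) j.val, Nat.range_succ_eq_Iic,
    ← Fin.map_valEmbedding_Iic, Finset.sum_map]
  rfl

theorem sum_Iio_fillingPart (i j : Fin r) :
    ∑ s ∈ Finset.Iio i, fillingPart W s j = partialPart W i.val (j.val + 1) := by
  rw [← sum_range_fillingPart W i.val j.val, ← Nat.Iio_eq_range,
    ← Fin.map_valEmbedding_Iio, Finset.sum_map]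
  rfl

/-- The second minors of the two partial sums for `s` cancel the first ones for `s + 1`. At `s = i`
the two first minors omit the same rows, as there is no row `0`. -/
theorem sum_Icc_fillingPart {i j : Fin r} (hij : i ≤ j) :
    ∑ s ∈ Finset.Icc i j, fillingPart W i s =
      omittedOrder W (j.val + 2 - i.val) (j.val + 1) -
        omittedOrder W (j.val + 1 - i.val) (j.val + 1) := by
  have key : ∀ n, i.val ≤ n → ∑ s ∈ Finset.Icc i.val n,
      (partialPart W (i.val + 1) (s + 1) - partialPart W i.val (s + 1)) =
        omittedOrder W (n + 2 - i.val) (n + 1) - omittedOrder W (n + 1 - i.val) (n + 1) := by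
    intro n hn
    induction n, hn using Nat.le_induction with
    | base =>
      have h1 : i.val + 1 - (i.val + 1) = 0 := by omega
      have h2 : i.val + 1 - i.val = 1 := by omega
      have h3 : i.val + 2 - i.val = 2 := by omega
      rw [Finset.Icc_self, Finset.sum_singleton, partialPart, partialPart, h1, h2, h3,
        Nat.add_sub_cancel, omittedOrder_eq W 0, omittedRows_zero, ← omittedOrder_eq]
      ring
    | succ n hn ih =>
      have h1 : n + 1 + 1 - (i.val + 1) = n + 1 - i.val := by omega
      have h2 : n + 1 - i.val + 1 = n + 2 - i.val := by omega
      have h3 : n + 1 + 1 - i.val = n + 2 - i.val := by omega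
      have h4 : n + 1 + 2 - i.val = n + 2 - i.val + 1 := by omega
      rw [Finset.sum_Icc_succ_top (by omega), ih, partialPart, partialPart, h1, h2, h3, h4,
        Nat.add_sub_cancel]
      ring
  rw [← key j.val hij, ← Fin.map_valEmbedding_Icc, Finset.sum_map]
  rfl

end FillingPart

/-! ### The conditions of a Littlewood-Richardson filling. -/

namespace IsMuGeneric

variable {K : Type*} [Field K] {r : ℕ} {μ ν lam : Fin r → ℝ}
  {N W : Matrix.GeneralLinearGroup (Fin r) (SeriesField K)}

theorem add_partialPart_self (hW : IsMuGeneric μ N W)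
    (hlam : IsInvariantPartition (diagT K μ * W) lam) (j : Fin r) :
    μ j + partialPart W.val (j.val + 1) (j.val + 1) = lam j := by
  have h1 := hW.rowOrd_omittedRows_one hlam j.isLt.le
  have h2 := hW.rowOrd_omittedRows_one hlam (Nat.succ_le_of_lt j.isLt)
  have hj : j ∉ omittedRows r 1 (j.val + 1) := by rw [mem_omittedRows]; omega
  have h3 : partialPart W.val (j.val + 1) (j.val + 1) =
      rowOrd W.val (omittedRows r 1 j.val) - rowOrd W.val (omittedRows r 1 (j.val + 1)) := by
    rw [partialPart, Nat.sub_self, Nat.add_sub_cancel, omittedOrder_eq, omittedOrder_eq,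
      omittedRows_zero]
  rw [h3]
  rw [← insert_omittedRows_right j rfl, Finset.sum_insert hj, Finset.sum_insert hj] at h1
  rw [← insert_omittedRows_right j rfl]
  linarith

theorem sum_Ici_fillingPart (hW : IsMuGeneric μ N W) (hν : IsInvariantPartition W ν) (i : Fin r) :
    ∑ s ∈ Finset.Ici i, fillingPart W.val i s = ν i := by
  have hlast : Finset.Ici i = Finset.Icc i ⟨r - 1, Nat.sub_one_lt_of_lt i.isLt⟩ := by
    ext x
    simp only [Finset.mem_Ici, Finset.mem_Icc, Fin.le_def]
    omega
  have h1 := hW.rowOrd_omittedRows_top hν i.isLt.le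
  have h2 := hW.rowOrd_omittedRows_top hν (Nat.succ_le_of_lt i.isLt)
  have hi : i ∉ omittedRows r 1 (i.val + 1) := by rw [mem_omittedRows]; omega
  rw [← insert_omittedRows_right i rfl, Finset.sum_insert hi] at h1
  have e1 : r - 1 + 2 - i.val = r - i.val + 1 := by omega
  have e2 : r - 1 + 1 - i.val = r - (i.val + 1) + 1 := by omega
  have e3 : r - 1 + 1 = r := by omega
  rw [hlast, sum_Icc_fillingPart _ (Fin.le_def.2 (by simp only; omega))]
  simp only [e1, e2]
  rw [e3, omittedOrder_eq, omittedOrder_eq]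
  have h2' : rowOrd W.val (omittedRows r (r - (i.val + 1) + 1) r) = _ := h2
  linarith

theorem sum_add_sum (hW : IsMuGeneric μ N W) (hν : IsInvariantPartition W ν)
    (hlam : IsInvariantPartition (diagT K μ * W) lam) :
    ∑ i, μ i + ∑ i, ν i = ∑ i, lam i := by
  -- With nothing omitted, both corners are the full determinant.
  have h1 := hW.rowOrd_omittedRows_one hlam (Nat.zero_le r)
  have h2 := hW.rowOrd_omittedRows_top hν (Nat.zero_le r)
  rw [omittedRows_eq_univ (by omega)] at h1 h2
  rw [omittedRows_eq_univ (by omega)] at h2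
  rw [← h1, ← h2]

/-- With `C` omitting rows `p + 1, …, j + 1` (one-based) and `x`, `y` the first two of these, the
claim is `[Cx] + [Cxj] ≤ [Cj] + [Cxy]`. By the Plücker relation the right side is at least `[Cx] +
[Cyj]` or `[Cy] + [Cxj]`, and replacing `y` by the smaller `x` lowers either one. -/
theorem fillingPart_nonneg (hW : IsMuGeneric μ N W) {i j : Fin r} (hij : i < j) :
    0 ≤ fillingPart W.val i j := by
  have hij' : i.val < j.val := hij
  obtain ⟨p, hp⟩ : ∃ p, j.val = i.val + (p + 1) := ⟨j.val - i.val - 1, by omega⟩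
  let x : Fin r := ⟨p, by omega⟩
  let y : Fin r := ⟨p + 1, by omega⟩
  set C := omittedRows r (p + 1) (j.val + 1) with hC
  have hx : x ∉ C := by rw [mem_omittedRows]; simp only [x]; omega
  have hy : y ∉ C := by rw [mem_omittedRows]; simp only [y]; omega
  have hj : j ∉ C := by rw [mem_omittedRows]; omega
  have e1 : j.val + 1 - (i.val + 1) = p + 1 := by omega
  have e2 : j.val + 1 - i.val = p + 2 := by omega
  have r1 : omittedRows r (p + 1) j.val = insert j C := (insert_omittedRows_right j rfl).symm
  have r2 : omittedRows r (p + 2) (j.val + 1) = insert x C :=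
    (insert_omittedRows_left x rfl).symm
  have r3 : omittedRows r (p + 2) j.val = insert x (insert j C) := by
    rw [← r1, insert_omittedRows_left x rfl]
  have r4 : omittedRows r (p + 3) (j.val + 1) = insert y (insert x C) := by
    rw [← r2, insert_omittedRows_left y rfl]
  have hxj : x ≤ j := Fin.le_def.2 (by simp only [x]; omega)
  have hxy : x ≤ y := Fin.le_def.2 (by simp only [x, y]; omega)
  rw [fillingPart, partialPart, partialPart, e1, e2, Nat.add_sub_cancel]
  simp only [omittedOrder_eq, r1, r2, r3, r4]
  have hlt := hW.rowOrd_insert_le hx hj hxj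
  have nxj : x ≠ j := by simp only [x, ne_eq, Fin.ext_iff]; omega
  have nxy : x ≠ y := by simp only [x, y, ne_eq, Fin.ext_iff]; omega
  -- This is the case `i = 0`: only two rows are omitted and a single exchange suffices.
  by_cases hyj : y = j
  · rw [hyj, Finset.insert_comm j x]
    linarith
  · have h := hW.min_rowOrd_le hj hx hy nxj.symm (Ne.symm hyj) nxy
    rw [Finset.insert_comm y x]
    rcases min_le_iff.1 h with h | h
    · have h' := hW.rowOrd_insert_le (C := insert j C) (a := x) (b := y)
        (by simp [nxj, hx]) (by simp [hyj, hy]) hxy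
      rw [Finset.insert_comm j y] at h
      linarith
    · have h' := hW.rowOrd_insert_le hx hy hxy
      rw [Finset.insert_comm j x] at h
      linarith

/-- The claim is `[Cj] + [Cxj] ≤ [Cx] + [Cj'j] + μ j' - μ j`. The Plücker relation bounds `[Cx] +
[Cj'j]` below by `[Cj'] + [Cxj]` or `[Cj] + [Cxj']`; exchanging `j'` for `j` costs at most `μ j' - μ
j`. -/
theorem add_partialPart_le (hW : IsMuGeneric μ N W) {i j j' : Fin r} (hj' : j'.val + 1 = j.val)
    (hij : i < j) : μ j + partialPart W.val (i.val + 1) (j.val + 1) ≤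
      μ j' + partialPart W.val i.val (j'.val + 1) := by
  have hij' : i.val < j.val := hij
  obtain ⟨p, hp⟩ : ∃ p, j.val = i.val + (p + 1) := ⟨j.val - i.val - 1, by omega⟩
  let x : Fin r := ⟨p, by omega⟩
  set C := omittedRows r (p + 1) (j.val + 1) with hC
  have hx : x ∉ C := by rw [mem_omittedRows]; simp only [x]; omega
  have hy : j' ∉ C := by rw [mem_omittedRows]; omega
  have hj : j ∉ C := by rw [mem_omittedRows]; omega
  have e1 : j.val + 1 - (i.val + 1) = p + 1 := by omega
  have e2 : j.val - i.val = p + 1 := by omega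
  have r1 : omittedRows r (p + 1) j.val = insert j C := (insert_omittedRows_right j rfl).symm
  have r2 : omittedRows r (p + 2) (j.val + 1) = insert x C :=
    (insert_omittedRows_left x rfl).symm
  have r3 : omittedRows r (p + 2) j.val = insert x (insert j C) := by
    rw [← r1, insert_omittedRows_left x rfl]
  have r4 : omittedRows r (p + 1) j'.val = insert j' (insert j C) := by
    rw [← r1, ← hj', insert_omittedRows_right j' rfl]
  have e3 : j.val - 1 = j'.val := by omega
  have hyj : j' ≤ j := Fin.le_def.2 (by omega)
  have nyj : j' ≠ j := by simp only [ne_eq, Fin.ext_iff]; omega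
  have nxj : x ≠ j := by simp only [x, ne_eq, Fin.ext_iff]; omega
  rw [partialPart, partialPart, e1, hj', e2, Nat.add_sub_cancel, e3]
  simp only [omittedOrder_eq, r1, r2, r3, r4]
  -- Again the case `i = 0`, where `x` and `j'` coincide.
  by_cases hxy : x = j'
  · have h := hW.rowOrd_insert_le_add hy hj hyj
    rw [hxy]
    linarith
  · have h := hW.min_rowOrd_le hx hy hj hxy nxj nyj
    rcases min_le_iff.1 h with h | h
    · have h' := hW.rowOrd_insert_le_add hy hj hyj
      linarith
    · have h' := hW.rowOrd_insert_le_add (C := insert x C) (a := j') (b := j)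
        (by simp [Ne.symm hxy, hy]) (by simp [Ne.symm nxj, hj]) hyj
      rw [Finset.insert_comm j' x, Finset.insert_comm j x] at h'
      linarith

/-- After telescoping, the claim is `[Cx] - [C] ≤ [Cxj'] - [Cj']`. -/
theorem sum_Icc_fillingPart_succ_le (hW : IsMuGeneric μ N W) {i j i' j' : Fin r}
    (hi : i'.val = i.val + 1) (hj : j'.val = j.val + 1) (hij : i ≤ j) :
    ∑ s ∈ Finset.Icc i' j', fillingPart W.val i' s ≤
      ∑ s ∈ Finset.Icc i j, fillingPart W.val i s := by
  have hij' : i.val ≤ j.val := hij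
  obtain ⟨p, hp⟩ : ∃ p, j.val = i.val + p := ⟨j.val - i.val, by omega⟩
  let x : Fin r := ⟨p, by omega⟩
  set C := omittedRows r (p + 1) (j'.val + 1) with hC
  have hx : x ∉ C := by rw [mem_omittedRows]; simp only [x]; omega
  have hy : j' ∉ C := by rw [mem_omittedRows]; omega
  have nxy : x ≠ j' := by simp only [x, ne_eq, Fin.ext_iff]; omega
  have r1 : omittedRows r (p + 1) j'.val = insert j' C := (insert_omittedRows_right j' rfl).symm
  have r2 : omittedRows r (p + 2) (j'.val + 1) = insert x C :=
    (insert_omittedRows_left x rfl).symm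
  have r3 : omittedRows r (p + 2) j'.val = insert x (insert j' C) := by
    rw [← r1, insert_omittedRows_left x rfl]
  have e1 : j.val + 2 - i.val = p + 2 := by omega
  have e2 : j.val + 1 - i.val = p + 1 := by omega
  have e3 : j'.val + 2 - i'.val = p + 2 := by omega
  have e4 : j'.val + 1 - i'.val = p + 1 := by omega
  rw [sum_Icc_fillingPart _ hij, sum_Icc_fillingPart _ (Fin.le_def.2 (by omega)), e1, e2, e3, e4,
    ← hj]
  simp only [omittedOrder_eq, r1, r2, r3]
  have h := hW.rowOrd_insert_add_le hx hy nxy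
  linarith

/-- The array of a `μ`-generic matrix is a Littlewood-Richardson filling. -/
theorem isLRFilling (hW : IsMuGeneric μ N W) (hμ : Antitone μ) (hν : IsInvariantPartition W ν)
    (hlam : IsInvariantPartition (diagT K μ * W) lam) :
    IsLRFilling μ ν lam (fillingPart W.val) where
  antitone_mu := hμ
  antitone_nu := hν.1
  antitone_lam := hlam.1
  size := hW.sum_add_sum hν hlam
  sum_col j := by rw [sum_Iic_fillingPart, hW.add_partialPart_self hlam]
  sum_row := hW.sum_Ici_fillingPart hν
  nonneg _ _ := hW.fillingPart_nonneg
  column i j j' hj' hij := by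
    rw [sum_Iic_fillingPart, sum_Iio_fillingPart]
    rcases hij.lt_or_eq with h | rfl
    · exact hW.add_partialPart_le hj' h
    -- On the diagonal both sides are complete sums, and the claim is `lam j ≤ lam j'`.
    · rw [hW.add_partialPart_self hlam, ← hj', hW.add_partialPart_self hlam]
      exact hlam.1 (Fin.le_def.2 (by omega))
  word _ _ _ _ hi hj := hW.sum_Icc_fillingPart_succ_le hi hj

end IsMuGeneric

end

/-! ### The main theorem. -/

theorem mainTheorem3 {K : Type*} [Field K] [CharZero K] {r : ℕ}
    (M N : Matrix.GeneralLinearGroup (Fin r) (SeriesField K))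
    (μ ν lam : Fin r → ℝ)
    (hμ : IsInvariantPartition M μ)
    (hν : IsInvariantPartition N ν)
    (hlam : IsInvariantPartition (M * N) lam)
    (N' : Matrix.GeneralLinearGroup (Fin r) (SeriesField K))
    (hN' : PairEquivalent M N (diagT K μ) N')
    (Nstar : Matrix.GeneralLinearGroup (Fin r) (SeriesField K))
    (hNstar : IsMuGeneric μ N' Nstar) :
    (∀ p q : ℕ, omittedMinor Nstar.val p q ≠ 0) ∧
    (∀ i j : Fin r, i ≤ j →
      ∑ s ∈ Finset.Iic i, fillingPart Nstar.val s j =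
        omittedOrder Nstar.val (j.val - i.val) j.val -
          omittedOrder Nstar.val (j.val - i.val + 1) (j.val + 1)) ∧
    IsLRFilling μ ν lam (fillingPart Nstar.val) := by
  refine ⟨fun p q => hNstar.rowMinor_ne_zero _, fun i j hij => ?_, ?_⟩
  · rw [sum_Iic_fillingPart, partialPart, Nat.add_sub_add_right, Nat.add_sub_cancel]
  · obtain ⟨P, hP, Q, hQ, T, hT, hD, rfl⟩ := hN'
    obtain ⟨Q', T', ⟨hQ', hQD⟩, hT', hW, -, -⟩ := hNstar.factor
    have hνW := (hν.mul_mul_inv hQ hT).mul_mul_inv hQ' hT'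
    rw [← hW] at hνW
    -- Admissibility carries `Q'` across `D_μ`: `D_μ N* = (D_μ Q' D_μ⁻¹) (P M N T⁻¹) T'⁻¹`, so `D_μ
    -- N*` keeps the invariants of `M N`.
    have hlamW := (hlam.mul_mul_inv hP hT).mul_mul_inv hQD hT'
    refine hNstar.isLRFilling hμ.1 hνW ?_
    convert hlamW using 1
    rw [hW, show P * (M * N) * T⁻¹ = diagT K μ * (Q * N * T⁻¹) by rw [hD]; group]
    group
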